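/- Let $[n]^d$ carry the coordinatewise order. For an integer $k\ge 1$, a function $f\colon[n]^d\to\{0,1\}$ is $k$-monotone if there are no $x_1\preceq x_2\preceq\dots\preceq x_{k+1}$ with $f(x_1)=1$ and $f(x_i)\neq f(x_{i+1})$ for all $1\le i\le k$. The distance of $f$ to $k$-monotonicity is the minimum, over $k$-monotone $g$, of the fraction of points $x\in[n]^d$ with $f(x)\ne g(x)$. A non-adaptive tolerant tester with query complexity $q$ is a randomized algorithm which, for given parameters $n,d,k,\varepsilon_1,\varepsilon_2$, queries $f$ on at most $q(n,d,\varepsilon_1,\varepsilon_2,k)$ points chosen depending only on its internal randomness (not on previous answers), and which accepts with probability at least $2/3$ every $f\colon[n]^d\to\{0,1\}$ at distance at most $\varepsilon_1$ from $k$-monotonicity, and rejects with probability at least $2/3$ every $f$ at distance at least $\varepsilon_2$. We write $\tilde O(F)$ for a quantity bounded by $C\,F\,(\log_2 F)^c$, where $C$ and $c\ge 0$ are absolute constants. **Theorem.** There exist: 1. a non-adaptive (fully) tolerant tester for $k$-monotonicity of functions $f\colon[n]^d\to\{0,1\}$, valid for all integers $n,d,k\ge 1$ and all $0\le\varepsilon_1<\varepsilon_2\le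 1$, with query complexity $$q(n,d,\varepsilon_1,\varepsilon_2,k)=\tilde O\!\left(\frac{1}{(\varepsilon_2-\varepsilon_1)^2}\left(\frac{5kd}{\varepsilon_2-\varepsilon_1}\right)^{d}\right);$$ 2. a non-adaptive tolerant tester for $k$-monotonicity of functions $f\colon[n]^d\to\{0,1\}$, valid for all integers $n,d,k\ge 1$ and all $0\le\varepsilon_1<\varepsilon_2\le 1$ with $\varepsilon_2>3\varepsilon_1$, with query complexity $$q(n,d,\varepsilon_1,\varepsilon_2,k)=2^{\tilde O\left(k\sqrt d/(\varepsilon_2-3\varepsilon_1)^2\right)}.$$ -/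

import Mathlib

noncomputable section

namespace KMonoTesting

/-- The hypergrid `[n]^d`. Its order is the coordinatewise (product) order. -/
abbrev Grid (n d : ℕ) : Type := Fin d → Fin n

/-- A Boolean function `f` on a poset is `k`-monotone if there is no chain
`x 0 ≤ x 1 ≤ ⋯ ≤ x k` with `f (x 0) = 1` along which consecutive values of `f` always differ. -/
def KMonotone {D : Type} [PartialOrder D] (k : ℕ) (f : D → Bool) : Prop :=
  ¬ ∃ x : Fin (k + 1) → D, Monotone x ∧ f (x 0) = true ∧
      ∀ i : Fin k, f (x i.castSucc) ≠ f (x i.succ)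

/-- The property of being `k`-monotone. It always contains the constant function `0`. -/
def kMonotoneProperty (D : Type) [PartialOrder D] (k : ℕ) : Set (D → Bool) :=
  {f | KMonotone k f}

/-- Normalized Hamming distance: the fraction of the points of `X` where `f` and `g` differ. -/
def relDist {X : Type} [Fintype X] (f g : X → Bool) : ℝ :=
  (hammingDist f g : ℝ) / (Fintype.card X : ℝ)

/-- Distance of `f` to a (nonempty) property `P`: the infimum of its distances to members. -/
def distTo {X : Type} [Fintype X] (f : X → Bool) (P : Set (X → Bool)) : ℝ :=
  sInf ((fun g => relDist f g) '' P)

/-- A randomized non-adaptive algorithm with query access to a function `X → Bool`.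
It draws its internal randomness `ω`; the list of queried points depends on `ω` only;
the verdict (`true` for ACCEPT, `false` for REJECT) depends on `ω` and on the answers. -/
structure NonadaptiveTester (X : Type) where
  Coin : Type
  coins : PMF Coin
  queries : Coin → List X
  verdict : Coin → List Bool → Bool

namespace NonadaptiveTester

variable {X : Type}

/-- The output on oracle `f` when the internal randomness is `ω`. -/
def run (T : NonadaptiveTester X) (f : X → Bool) (ω : T.Coin) : Bool :=
  T.verdict ω ((T.queries ω).map f)

/-- The distribution of the output on oracle `f`. -/
def output (T : NonadaptiveTester X) (f : X → Bool) : PMF Bool :=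
  T.coins.map (T.run f)

/-- The algorithm never makes more than `q` queries. -/
def MakesAtMost (T : NonadaptiveTester X) (q : ℕ) : Prop :=
  ∀ ω, (T.queries ω).length ≤ q

/-- Tolerant testing of `P` with parameters `ε₁ < ε₂`: functions at distance at most `ε₁` from
`P` are accepted, and functions at distance at least `ε₂` are rejected, each with probability
at least `2/3`. -/
def IsTolerantTester [Fintype X] (T : NonadaptiveTester X) (P : Set (X → Bool))
    (ε₁ ε₂ : ℝ) : Prop :=
  (∀ f : X → Bool, distTo f P ≤ ε₁ → 2 / 3 ≤ T.output f true) ∧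
  (∀ f : X → Bool, ε₂ ≤ distTo f P → 2 / 3 ≤ T.output f false)

end NonadaptiveTester

/-- The parameters that a tester for `k`-monotonicity of functions on `[n]^d` knows. -/
structure Params where
  n : ℕ
  d : ℕ
  k : ℕ
  ε₁ : ℝ
  ε₂ : ℝ

/-- The range of parameters of a fully tolerant tester. -/
def fullRange : Set Params :=
  {p | 1 ≤ p.n ∧ 1 ≤ p.d ∧ 1 ≤ p.k ∧ 0 ≤ p.ε₁ ∧ p.ε₁ < p.ε₂ ∧ p.ε₂ ≤ 1}

/-- The parameters with the additional restriction `3 ε₁ < ε₂`. -/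
def restrictedRange : Set Params :=
  {p | p ∈ fullRange ∧ 3 * p.ε₁ < p.ε₂}

/-- `g` is `Õ(F)`, that is `O(F log^c F)` for some constant `c`, uniformly over the parameters
in `S`; `log` is the binary logarithm. -/
def IsSoftO {ι : Type} (S : Set ι) (g F : ι → ℝ) : Prop :=
  ∃ (C : ℝ) (c : ℕ), ∀ p ∈ S, g p ≤ C * (F p * Real.logb 2 (F p) ^ c)

/-- A family of testers, one for each parameter setting, is a tolerant tester for
`k`-monotonicity on `[n]^d` with query complexity `q`, over the range `S` of parameters. -/
def IsKMonoTolerantTester (S : Set Params)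
    (T : (p : Params) → NonadaptiveTester (Grid p.n p.d)) (q : Params → ℕ) : Prop :=
  ∀ p ∈ S, (T p).MakesAtMost (q p) ∧
    (T p).IsTolerantTester (kMonotoneProperty (Grid p.n p.d) p.k) p.ε₁ p.ε₂

end KMonoTesting

end

/-! Both testers learn by means of a finite cover. Suppose a signature with values in a finite set
`S` determines every `k`-monotone function up to distance `(ε₂ - ε₁) / 2`. Keep one `k`-monotone
representative for each value and estimate, from one common uniform sample, the distance of `f` to
each of them; by Chernoff and a union bound, `O((1 + log |S|) / (ε₂ - ε₁)²)` samples are enough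
(`exists_tester_of_signature`). What remains is to find small signatures.

The structural input is that a `k`-monotone function is the parity of a monotone rank with values in
`{0, …, k}` (`KMonotone.exists_rank`), so the rank moves by at least `1` wherever the function
changes.

The first signature is the restriction to the lower corners of `m ^ d` blocks. Inside a block the
rank varies by at most its increase from that corner to the diagonally next one. Summed over all
blocks these increases telescope up to boundary terms, so a fraction of at most `k d / m` of the
points disagrees with its corner (`sum_ne_coarse_le`). With `m` about `4 k d / (ε₂ - ε₁)` this gives
`|S| = 2 ^ (m ^ d)`.

The second signature keeps, of the coarsened function, only the number of ones on each subgrid that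
fixes at most `t` coordinates. If `f` and `g` share these counts, then `f - g` has no Fourier weight
in degrees up to `t`, so `t + 1` times its squared norm is bounded by its total influence
(`sum_sq_le_of_marginals`). Monotone ranks bounded by `k` have total influence `O(k √d)`
(`sum_abs_sub_update_le`), whence `f` and `g` are `O(k √d / t)`-close (`relDist_le_of_marginals`),
and a table of `(d (m + 1)) ^ t` counts suffices. -/

namespace KMonoTesting

/-! ### Rank functions of `k`-monotone functions -/

section Rank

variable {D : Type} [PartialOrder D]

/-- `AltBelow f ℓ x`: below `x` there is a chain of length `ℓ` along which `f` takes the values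
`1, 0, 1, …` -/
def AltBelow (f : D → Bool) : ℕ → D → Prop
  | 0, _ => True
  | ℓ + 1, x => ∃ y ≤ x, f y = decide (Even ℓ) ∧ AltBelow f ℓ y

theorem AltBelow.mono {f : D → Bool} {ℓ : ℕ} {x y : D} (hxy : x ≤ y) (h : AltBelow f ℓ x) :
    AltBelow f ℓ y := by
  cases ℓ with
  | zero => trivial
  | succ ℓ =>
    obtain ⟨z, hz, h⟩ := h
    exact ⟨z, hz.trans hxy, h⟩

theorem AltBelow.exists_chain {f : D → Bool} {ℓ : ℕ} {x : D} (h : AltBelow f (ℓ + 1) x) :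
    ∃ c : ℕ → D, c ℓ ≤ x ∧ (∀ i < ℓ, c i ≤ c (i + 1)) ∧ ∀ i ≤ ℓ, f (c i) = decide (Even i) := by
  induction ℓ generalizing x with
  | zero =>
    obtain ⟨y, hy, hf, -⟩ := h
    refine ⟨fun _ => y, hy, fun i _ => le_rfl, fun i hi => ?_⟩
    obtain rfl : i = 0 := by omega
    exact hf
  | succ ℓ ih =>
    obtain ⟨y, hy, hf, h⟩ := h
    obtain ⟨c, hc, hmono, hval⟩ := ih h
    refine ⟨fun i => if i ≤ ℓ then c i else y, by simpa using hy, fun i hi => ?_, fun i hi => ?_⟩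
    · rcases Nat.lt_or_ge i ℓ with h' | h'
      · simpa [h'.le, Nat.succ_le_of_lt h'] using hmono i h'
      · obtain rfl : i = ℓ := by omega
        simpa using hc
    · by_cases h' : i ≤ ℓ
      · simpa [h'] using hval i h'
      · obtain rfl : i = ℓ + 1 := by omega
        simpa using hf

theorem KMonotone.not_altBelow {f : D → Bool} {k : ℕ} (hf : KMonotone k f) (x : D) :
    ¬ AltBelow f (k + 1) x := by
  intro h
  obtain ⟨c, -, hmono, hval⟩ := h.exists_chain
  refine hf ⟨fun i => c i, Fin.monotone_iff_le_succ.2 fun i => hmono i i.2, ?_, fun i => ?_⟩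
  · simpa using hval 0 (Nat.zero_le _)
  · simp only [Fin.val_castSucc, Fin.val_succ]
    rw [hval i i.2.le, hval (i + 1) i.2]
    simp only [Nat.even_add_one, ne_eq, decide_eq_decide]
    tauto

open Classical in
/-- A `k`-monotone function is the parity of a monotone function with values in `{0, …, k}`. -/
theorem KMonotone.exists_rank {f : D → Bool} {k : ℕ} (hf : KMonotone k f) :
    ∃ r : D → ℕ, Monotone r ∧ (∀ x, r x ≤ k) ∧ ∀ x, f x = decide (Odd (r x)) := by
  refine ⟨fun x => Nat.findGreatest (fun ℓ => AltBelow f ℓ x) k, fun x y hxy => ?_,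
    fun x => Nat.findGreatest_le k, fun x => ?_⟩
  · exact Nat.findGreatest_mono_left (fun ℓ h => h.mono hxy) k
  · set ℓ := Nat.findGreatest (fun ℓ => AltBelow f ℓ x) k with hℓ
    have h1 : AltBelow f ℓ x :=
      Nat.findGreatest_spec (P := fun ℓ => AltBelow f ℓ x) (Nat.zero_le k) trivial
    by_contra hne
    -- If `f x` had the wrong parity, `x` itself would prolong the alternating chain, against the
    -- maximality of `ℓ` or, when `ℓ = k`, against `k`-monotonicity.
    have h2 : AltBelow f (ℓ + 1) x := by
      refine ⟨x, le_rfl, ?_, h1⟩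
      have hne' : ¬ f x = decide (Odd ℓ) := hne
      by_cases he : Even ℓ
      · simpa [he, Nat.not_odd_iff_even.2 he] using hne'
      · simpa [he, Nat.not_even_iff_odd.1 he] using hne'
    rcases Nat.lt_or_ge ℓ k with h | h
    · exact absurd (Nat.le_findGreatest (P := fun ℓ => AltBelow f ℓ x) h h2) (by omega)
    · have : ℓ = k := le_antisymm (Nat.findGreatest_le k) h
      exact hf.not_altBelow x (this ▸ h2)

theorem KMonotone.comp {E : Type} [PartialOrder E] {f : D → Bool} {k : ℕ} (hf : KMonotone k f)
    {e : E → D} (he : Monotone e) : KMonotone k (f ∘ e) := fun ⟨x, hx, h0, h⟩ =>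
  hf ⟨e ∘ x, he.comp hx, h0, h⟩

theorem kMonotone_const {k : ℕ} (hk : 1 ≤ k) (b : Bool) : KMonotone k (fun _ : D => b) :=
  fun ⟨_, _, _, h⟩ => h ⟨0, hk⟩ rfl

end Rank

theorem card_ne_le_of_rank {D : Type} {f : D → Bool} {r : D → ℕ}
    (hr : ∀ x, f x = decide (Odd (r x))) {x y : D} :
    (if f x ≠ f y then (1 : ℝ) else 0) ≤ |(r x : ℝ) - r y| := by
  split_ifs with h
  · have hne : r x ≠ r y := fun e => h (by rw [hr, hr, e])
    have : (1 : ℤ) ≤ |(r x : ℤ) - r y| := Int.one_le_abs (by omega)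
    exact_mod_cast this
  · positivity

/-! ### Distance to a property -/

section Distance

variable {X : Type} [Fintype X]

theorem relDist_eq (f g : X → Bool) :
    relDist f g = (∑ x, if f x ≠ g x then (1 : ℝ) else 0) / Fintype.card X := by
  rw [Finset.sum_boole]; rfl

theorem relDist_nonneg (f g : X → Bool) : 0 ≤ relDist f g := by
  unfold relDist; positivity

theorem relDist_triangle (f g h : X → Bool) : relDist f h ≤ relDist f g + relDist g h := by
  unfold relDist
  rw [← add_div]
  gcongr
  exact_mod_cast hammingDist_triangle f g h

theorem bddBelow_relDist (f : X → Bool) (P : Set (X → Bool)) :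
    BddBelow ((fun g => relDist f g) '' P) :=
  ⟨0, by rintro _ ⟨g, -, rfl⟩; exact relDist_nonneg f g⟩

theorem distTo_le_relDist {f g : X → Bool} {P : Set (X → Bool)} (hg : g ∈ P) :
    distTo f P ≤ relDist f g :=
  csInf_le (bddBelow_relDist f P) ⟨g, hg, rfl⟩

theorem exists_relDist_eq_distTo (f : X → Bool) {P : Set (X → Bool)} (hP : P.Nonempty) :
    ∃ g ∈ P, relDist f g = distTo f P := by
  have hfin : ((fun g => relDist f g) '' P).Finite := (Set.toFinite P).image _
  exact (hP.image _).csInf_mem hfin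

/-- Both constants are `k`-monotone, and the distances of `f` to them add up to `1`. -/
theorem distTo_kMonotone_le_half [PartialOrder X] [Nonempty X] {k : ℕ} (hk : 1 ≤ k)
    (f : X → Bool) : distTo f (kMonotoneProperty X k) ≤ 1 / 2 := by
  have h0 := distTo_le_relDist (f := f) (P := kMonotoneProperty X k) 
    (show KMonotone k _ from kMonotone_const hk false)
  have h1 := distTo_le_relDist (f := f) (P := kMonotoneProperty X k) 
    (show KMonotone k _ from kMonotone_const hk true)
  have hsum : relDist f (fun _ => false) + relDist f (fun _ => true) = 1 := by
    rw [relDist_eq, relDist_eq, ← add_div, ← Finset.sum_add_distrib]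
    have : ∀ x, ((if f x ≠ false then (1 : ℝ) else 0) + if f x ≠ true then (1 : ℝ) else 0) = 1 := by
      intro x; cases f x <;> simp
    rw [Finset.sum_congr rfl fun x _ => this x]
    simp
  linarith

end Distance

/-! ### Chernoff bound and testing by a finite cover -/

section Tester

/-- Chernoff bound, in counting form. -/
theorem card_sum_ge_le {X : Type} [Fintype X] (Z : X → ℝ) (hZ : ∀ x, |Z x| ≤ 1)
    {γ : ℝ} (hγ : 0 ≤ γ) (hγ1 : γ ≤ 1)
    {μ : ℝ} (hμ : ∑ x, Z x = Fintype.card X * μ) (s : ℕ) :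
    ((Finset.univ.filter fun ω : Fin s → X => s * (μ + γ) ≤ ∑ j, Z (ω j)).card : ℝ) ≤
      (Fintype.card X : ℝ) ^ s * Real.exp (-(s * γ ^ 2 / 4)) := by
  -- This choice minimises the exponent `t ^ 2 - t * γ` that comes out of Markov's inequality for
  -- `exp (t * ∑ Z)`.
  set t : ℝ := γ / 2 with ht
  have h1 : ∑ x, Real.exp (t * Z x) ≤ Fintype.card X * Real.exp (t * μ + t ^ 2) := by
    have hb : ∀ x, Real.exp (t * Z x) ≤ 1 + t * Z x + t ^ 2 := fun x => by
      have hle : |t * Z x| ≤ t := by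
        rw [abs_mul, abs_of_nonneg (by positivity)]
        exact mul_le_of_le_one_right (by positivity) (hZ x)
      have := (abs_le.1 (Real.abs_exp_sub_one_sub_id_le (x := t * Z x) (by linarith))).2
      have h2 : (t * Z x) ^ 2 ≤ t ^ 2 := by
        rw [← sq_abs (t * Z x)]; gcongr
      linarith
    calc ∑ x, Real.exp (t * Z x) ≤ ∑ x, (1 + t * Z x + t ^ 2) := Finset.sum_le_sum fun x _ => hb x
      _ = Fintype.card X * (t * μ + t ^ 2 + 1) := by
        simp only [Finset.sum_add_distrib, ← Finset.mul_sum, hμ, Finset.sum_const,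
          Finset.card_univ, nsmul_eq_mul]
        ring
      _ ≤ _ := by gcongr; exact Real.add_one_le_exp _
  have h2 : ((Finset.univ.filter fun ω : Fin s → X => s * (μ + γ) ≤ ∑ j, Z (ω j)).card : ℝ) *
      Real.exp (t * (s * (μ + γ))) ≤ ∑ ω : Fin s → X, Real.exp (t * ∑ j, Z (ω j)) := by
    rw [← nsmul_eq_mul, ← Finset.sum_const]
    refine (Finset.sum_le_sum fun ω hω => ?_).trans
      (Finset.sum_le_sum_of_subset_of_nonneg (Finset.filter_subset _ _)
        fun _ _ _ => (Real.exp_pos _).le)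
    have := (Finset.mem_filter.1 hω).2
    gcongr
  have h3 : ∑ ω : Fin s → X, Real.exp (t * ∑ j, Z (ω j)) = (∑ x, Real.exp (t * Z x)) ^ s := by
    simp only [Finset.mul_sum, Real.exp_sum]
    rw [← Fin.prod_const, Finset.prod_univ_sum, Fintype.piFinset_univ]
  rw [h3] at h2
  have h4 : (∑ x, Real.exp (t * Z x)) ^ s ≤ (Fintype.card X * Real.exp (t * μ + t ^ 2)) ^ s :=
    pow_le_pow_left₀ (Finset.sum_nonneg fun _ _ => (Real.exp_pos _).le) h1 s
  have h5 := h2.trans h4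
  rw [mul_pow, ← Real.exp_nat_mul, ← le_div_iff₀ (Real.exp_pos _), mul_div_assoc,
    ← Real.exp_sub] at h5
  refine h5.trans_eq ?_
  congr 2
  rw [ht]; ring

theorem output_uniform_apply {X Ω : Type} [Fintype Ω] [Nonempty Ω] [DecidableEq Ω] (q : Ω → List X)
    (v : Ω → List Bool → Bool) (f : X → Bool) (b : Bool)
    (h : 3 * ((Finset.univ.filter fun ω => v ω ((q ω).map f) ≠ b).card : ℝ) ≤ Fintype.card Ω) :
    2 / 3 ≤ (NonadaptiveTester.mk Ω (PMF.uniformOfFintype Ω) q v).output f b := by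
  have hpos : (0 : ℝ) < Fintype.card Ω := by exact_mod_cast Fintype.card_pos
  have hsum := Finset.card_filter_add_card_filter_not (s := (Finset.univ : Finset Ω))
    (fun ω => v ω ((q ω).map f) = b)
  have hval : (NonadaptiveTester.mk Ω (PMF.uniformOfFintype Ω) q v).output f b =
      ENNReal.ofReal (((Finset.univ.filter fun ω => v ω ((q ω).map f) = b).card : ℝ) /
        Fintype.card Ω) := by
    rw [ENNReal.ofReal_div_of_pos hpos, ENNReal.ofReal_natCast, ENNReal.ofReal_natCast]
    simp only [NonadaptiveTester.output, PMF.map_apply, NonadaptiveTester.run,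
      PMF.uniformOfFintype_apply]
    rw [tsum_fintype, ← Finset.sum_filter, Finset.sum_const, nsmul_eq_mul, ENNReal.div_eq_inv_mul,
      mul_comm]
    simp only [eq_comm]
  have h23 : (2 / 3 : ENNReal) = ENNReal.ofReal (2 / 3) := by
    rw [ENNReal.ofReal_div_of_pos (by norm_num)]; norm_num
  rw [hval, h23]
  apply ENNReal.ofReal_le_ofReal
  rw [le_div_iff₀ hpos]
  have : (((Finset.univ.filter fun ω => v ω ((q ω).map f) = b).card : ℝ) +
      (Finset.univ.filter fun ω => v ω ((q ω).map f) ≠ b).card) = Fintype.card Ω := by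
    exact_mod_cast hsum
  linarith

open Classical in
/-- If a map with finite range `S` determines the members of `P` up to distance `(ε₂ - ε₁) / 2`,
then `O((1 + log |S|) / (ε₂ - ε₁)²)` uniform samples suffice for tolerant testing of `P`. -/
theorem exists_tester_of_signature {X : Type} [Fintype X] [Nonempty X] {P : Set (X → Bool)}
    (hP : P.Nonempty) {S : Type} [Fintype S] (σ : (X → Bool) → S) {ε₁ ε₂ : ℝ} (hε : ε₁ < ε₂)
    (hε₂ : ε₂ - ε₁ ≤ 1)
    (hσ : ∀ f ∈ P, ∀ g ∈ P, σ f = σ g → relDist f g ≤ (ε₂ - ε₁) / 2) {s : ℕ}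
    (hs : 64 * (Real.log (Fintype.card S) + Real.log 3) / (ε₂ - ε₁) ^ 2 ≤ s) :
    ∃ T : NonadaptiveTester X, T.MakesAtMost s ∧ T.IsTolerantTester P ε₁ ε₂ := by
  set δ := ε₂ - ε₁ with hδ
  have hδ0 : 0 < δ := sub_pos.2 hε
  obtain ⟨g₀, hg₀⟩ := hP
  have hS : 0 < Fintype.card S := Fintype.card_pos_iff.2 ⟨σ g₀⟩
  have hrep : ∀ a : S, ∃ c ∈ P, ∀ g ∈ P, σ g = a → relDist g c ≤ δ / 2 := by
    intro a
    by_cases h : ∃ c ∈ P, σ c = a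
    · obtain ⟨c, hc, rfl⟩ := h
      exact ⟨c, hc, fun g hg e => hσ g hg c hc e⟩
    · push Not at h
      -- Values not attained on `P` get a default that still lies in `P`; soundness needs every
      -- representative in `P`.
      exact ⟨g₀, hg₀, fun g hg e => absurd e (h g hg)⟩
  choose c hcP hc using hrep
  set err : (X → Bool) → (Fin s → X) → S → ℝ :=
    fun f ω a => ∑ j, if f (ω j) ≠ c a (ω j) then (1 : ℝ) else 0 with herr
  -- The threshold is halfway between `ε₁ + δ / 2`, the distance guaranteed to some representative
  -- in the accepting case, and `ε₂ = ε₁ + δ`. Either error thus needs a deviation of `δ / 4`.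
  set v : (Fin s → X) → List Bool → Bool := fun ω l =>
    decide (∃ a : S, ∃ b : Fin s → Bool, l = List.ofFn b ∧
      (∑ j, if b j ≠ c a (ω j) then (1 : ℝ) else 0) < s * (ε₁ + 3 / 4 * δ)) with hv
  have hverdict : ∀ f ω, v ω ((List.ofFn ω).map f) =
      decide (∃ a : S, err f ω a < s * (ε₁ + 3 / 4 * δ)) := by
    intro f ω
    simp only [hv, herr, List.map_ofFn, List.ofFn_inj, decide_eq_decide]
    constructor
    · rintro ⟨a, b, rfl, h⟩; exact ⟨a, h⟩
    · rintro ⟨a, h⟩; exact ⟨a, _, rfl, h⟩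
  have hX : (0 : ℝ) < Fintype.card X := by exact_mod_cast Fintype.card_pos
  have hmean : ∀ f a, ∑ x, (if f x ≠ c a x then (1 : ℝ) else 0) =
      Fintype.card X * relDist f (c a) := by
    intro f a; rw [relDist_eq]; field_simp
  have hexp : 3 * ((Fintype.card S : ℝ) * Real.exp (-(s * (δ / 4) ^ 2 / 4))) ≤ 1 := by
    have hS' : (0 : ℝ) < Fintype.card S := by exact_mod_cast hS
    have h1 : Real.log (Fintype.card S) + Real.log 3 ≤ s * (δ / 4) ^ 2 / 4 := by
      rw [div_le_iff₀ (by positivity)] at hs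
      linarith
    calc 3 * ((Fintype.card S : ℝ) * Real.exp (-(s * (δ / 4) ^ 2 / 4)))
        ≤ 3 * ((Fintype.card S : ℝ) * Real.exp (-(Real.log (Fintype.card S) + Real.log 3))) := by
          gcongr
      _ = 1 := by
        rw [Real.exp_neg, Real.exp_add, Real.exp_log hS', Real.exp_log (by norm_num)]
        field_simp
  have hcard : (Fintype.card (Fin s → X) : ℝ) = (Fintype.card X : ℝ) ^ s := by simp
  refine ⟨⟨Fin s → X, PMF.uniformOfFintype _, fun ω => List.ofFn ω, v⟩, fun ω => by simp,
    fun f hf => ?_, fun f hf => ?_⟩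
  · refine output_uniform_apply _ _ f true ?_
    simp only [hverdict]
    obtain ⟨g, hg, hgf⟩ := exists_relDist_eq_distTo f ⟨g₀, hg₀⟩
    have hdist : relDist f (c (σ g)) ≤ ε₁ + δ / 2 := by
      have := relDist_triangle f g (c (σ g))
      have := hc _ g hg rfl
      linarith
    have hch := card_sum_ge_le (fun x => if f x ≠ c (σ g) x then (1 : ℝ) else 0)
      (fun x => by split_ifs <;> simp) (γ := δ / 4) (by positivity) (by linarith)
      (hmean f (σ g)) s
    have hsub : ((Finset.univ.filter fun ω : Fin s → X =>
        decide (∃ a : S, err f ω a < s * (ε₁ + 3 / 4 * δ)) ≠ true).card : ℝ) ≤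
        (Finset.univ.filter fun ω : Fin s → X => s * (relDist f (c (σ g)) + δ / 4) ≤
          ∑ j, if f (ω j) ≠ c (σ g) (ω j) then (1 : ℝ) else 0).card := by
      refine Nat.cast_le.2 (Finset.card_le_card fun ω hω => ?_)
      simp only [Finset.mem_filter, Finset.mem_univ, true_and, ne_eq, decide_eq_true_eq,
        not_exists, not_lt] at hω ⊢
      refine le_trans ?_ (hω (σ g))
      exact mul_le_mul_of_nonneg_left (by linarith) (Nat.cast_nonneg s)
    have hS1 : (1 : ℝ) ≤ Fintype.card S := by exact_mod_cast hS
    rw [hcard]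
    have h6 : Real.exp (-(s * (δ / 4) ^ 2 / 4)) ≤
        Fintype.card S * Real.exp (-(s * (δ / 4) ^ 2 / 4)) :=
      le_mul_of_one_le_left (Real.exp_pos _).le hS1
    have h7 : (Fintype.card X : ℝ) ^ s * (3 * Real.exp (-(s * (δ / 4) ^ 2 / 4))) ≤
        (Fintype.card X : ℝ) ^ s * 1 := by
      gcongr
      linarith
    linarith
  · refine output_uniform_apply _ _ f false ?_
    simp only [hverdict]
    -- Negated indicators turn the upper tail bound into a lower one; here the union bound runs over
    -- all representatives.
    have hch := fun a => card_sum_ge_le (fun x => -if f x ≠ c a x then (1 : ℝ) else 0)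
      (fun x => by split_ifs <;> simp) (γ := δ / 4) (by positivity) (by linarith)
      (μ := -relDist f (c a)) (by rw [Finset.sum_neg_distrib, hmean f a]; ring) s
    have hsub : ((Finset.univ.filter fun ω : Fin s → X =>
        decide (∃ a : S, err f ω a < s * (ε₁ + 3 / 4 * δ)) ≠ false).card : ℝ) ≤
        ∑ a : S, ((Finset.univ.filter fun ω : Fin s → X => s * (-relDist f (c a) + δ / 4) ≤
          ∑ j, -if f (ω j) ≠ c a (ω j) then (1 : ℝ) else 0).card : ℝ) := by
      rw [← Nat.cast_sum]
      refine Nat.cast_le.2 ((Finset.card_le_card fun ω hω => ?_).trans Finset.card_biUnion_le)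
      simp only [Finset.mem_filter, Finset.mem_univ, true_and, ne_eq, decide_eq_false_iff_not,
        not_not, Finset.mem_biUnion] at hω ⊢
      obtain ⟨a, ha⟩ := hω
      refine ⟨a, ?_⟩
      have hda : ε₂ ≤ relDist f (c a) := hf.trans (distTo_le_relDist (hcP a))
      have h8 : (s : ℝ) * (-relDist f (c a) + δ / 4) ≤ s * -(ε₁ + 3 / 4 * δ) := by
        gcongr
        linarith
      rw [Finset.sum_neg_distrib]
      simp only [herr, ne_eq] at ha
      linarith
    have h9 := hsub.trans (Finset.sum_le_sum fun a _ => hch a)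
    rw [Finset.sum_const, nsmul_eq_mul, Finset.card_univ] at h9
    rw [hcard]
    have h7 : (Fintype.card X : ℝ) ^ s *
        (3 * (Fintype.card S * Real.exp (-(s * (δ / 4) ^ 2 / 4)))) ≤
        (Fintype.card X : ℝ) ^ s * 1 := by
      gcongr
    linarith

end Tester

/-! ### Total influence of monotone functions -/

section Influence

variable {ι V : Type} [Fintype ι] [DecidableEq ι] [Fintype V]

/-- Exchanging the `i`-th coordinate with an independent copy preserves the uniform measure. -/
theorem sum_sum_update_swap (i : ι) (F : (ι → V) → V → ℝ) :
    ∑ x, ∑ v, F (Function.update x i v) (x i) = ∑ x, ∑ v, F x v := by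
  rw [← Fintype.sum_prod_type', ← Fintype.sum_prod_type']
  refine Fintype.sum_equiv (Function.Involutive.toPerm
    (fun p : (ι → V) × V => (Function.update p.1 i p.2, p.1 i)) fun p => ?_) _ _ fun p => rfl
  simp

/-- The signed position of `a` in `Fin m`, centred at `0`. -/
def centred {m : ℕ} (a : Fin m) : ℝ :=
  ∑ v : Fin m, if v < a then (1 : ℝ) else if a < v then -1 else 0

theorem abs_centred_le {m : ℕ} (a : Fin m) : |centred a| ≤ m := by
  refine (Finset.abs_sum_le_sum_abs _ _).trans ?_
  calc _ ≤ ∑ _v : Fin m, (1 : ℝ) := Finset.sum_le_sum fun v _ => by split_ifs <;> simp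
    _ = m := by simp

theorem sum_centred (m : ℕ) : ∑ a : Fin m, centred a = 0 := by
  have h : ∑ a : Fin m, centred a = -∑ a : Fin m, centred a := by
    conv_lhs => unfold centred
    rw [Finset.sum_comm, ← Finset.sum_neg_distrib]
    refine Finset.sum_congr rfl fun a _ => ?_
    rw [centred, ← Finset.sum_neg_distrib]
    refine Finset.sum_congr rfl fun v _ => ?_
    rcases lt_trichotomy a v with h | h | h
    · simp [h, h.not_gt]
    · simp [h]
    · simp [h, h.not_gt]
  linarith

/-- Distinct coordinates are independent and `centred` has mean zero, so only the diagonal terms of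
the square survive. -/
theorem sum_sq_sum_centred_le (m : ℕ) :
    ∑ x : ι → Fin m, (∑ i, centred (x i)) ^ 2 ≤
      Fintype.card ι * (m : ℝ) ^ 2 * (m : ℝ) ^ Fintype.card ι := by
  have hoff : ∀ i j, i ≠ j → ∑ x : ι → Fin m, centred (x i) * centred (x j) = 0 := by
    intro i j hij
    have h := sum_sum_update_swap (V := Fin m) i fun x v => centred v * centred (x j)
    simp only [Function.update_of_ne hij.symm, ← Finset.sum_mul, sum_centred, zero_mul,
      Finset.sum_const_zero, Finset.sum_const, Finset.card_univ, nsmul_eq_mul,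
      Fintype.card_fin, mul_assoc] at h
    rw [← Finset.mul_sum] at h
    rcases mul_eq_zero.1 h with h0 | h0
    · have : m = 0 := by exact_mod_cast h0
      subst this
      refine Finset.sum_eq_zero fun x _ => (x i).elim0
    · exact h0
  calc ∑ x : ι → Fin m, (∑ i, centred (x i)) ^ 2
      = ∑ i, ∑ j, ∑ x : ι → Fin m, centred (x i) * centred (x j) := by
        simp_rw [sq, Finset.sum_mul_sum]
        rw [Finset.sum_comm]
        exact Finset.sum_congr rfl fun i _ => Finset.sum_comm
    _ = ∑ i, ∑ x : ι → Fin m, centred (x i) * centred (x i) :=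
        Finset.sum_congr rfl fun i _ => Finset.sum_eq_single i
          (fun j _ hj => hoff i j hj.symm) (by simp)
    _ ≤ ∑ _i : ι, ∑ _x : ι → Fin m, (m : ℝ) ^ 2 := by
        refine Finset.sum_le_sum fun i _ => Finset.sum_le_sum fun x _ => ?_
        rw [← abs_mul_abs_self, ← sq]
        exact pow_le_pow_left₀ (abs_nonneg _) (abs_centred_le _) 2
    _ = _ := by simp; ring

/-- The total influence of a bounded monotone function on `[m]^d` is `O(√d)`. -/
theorem sum_abs_sub_update_le {m : ℕ} {k : ℝ} {r : (ι → Fin m) → ℝ} (hr : Monotone r)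
    (h0 : ∀ x, 0 ≤ r x) (hk : ∀ x, r x ≤ k) (hk0 : 0 ≤ k) :
    ∑ i, ∑ x, ∑ v, |r x - r (Function.update x i v)| ≤
      2 * k * √(Fintype.card ι) * (m : ℝ) ^ (Fintype.card ι + 1) := by
  set sg : Fin m → Fin m → ℝ := fun a v => if v < a then 1 else if a < v then -1 else 0 with hsg
  have hanti : ∀ a v, sg v a = -sg a v := by
    intro a v
    simp only [hsg]
    rcases lt_trichotomy a v with h | h | h
    · simp [h, h.not_gt]
    · simp [h]
    · simp [h, h.not_gt]
  -- Monotonicity fixes the sign of the difference, so the influence is linear in `r`: a correlation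
  -- with `∑ i, centred (x i)`, to which Cauchy–Schwarz applies.
  have habs : ∀ i x v, |r x - r (Function.update x i v)| =
      sg (x i) v * r x - sg (x i) v * r (Function.update x i v) := by
    intro i x v
    rcases lt_trichotomy (x i) v with h | h | h
    · have := hr (show x ≤ Function.update x i v from le_update_iff.2 ⟨h.le, fun _ _ => le_rfl⟩)
      rw [abs_of_nonpos (by linarith)]
      simp [hsg, h, h.not_gt]; ring
    · simp [hsg, ← h]
    · have := hr (show Function.update x i v ≤ x from update_le_iff.2 ⟨h.le, fun _ _ => le_rfl⟩)
      rw [abs_of_nonneg (by linarith)]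
      simp [hsg, h]
  have hi : ∀ i, ∑ x, ∑ v, |r x - r (Function.update x i v)| = 2 * ∑ x, r x * centred (x i) := by
    intro i
    have h1 : ∑ x, ∑ v, sg (x i) v * r x = ∑ x, r x * centred (x i) := by
      refine Finset.sum_congr rfl fun x _ => ?_
      rw [← Finset.sum_mul, mul_comm]; rfl
    have h2 := sum_sum_update_swap i fun x v => sg v (x i) * r x
    simp only [Function.update_self] at h2
    simp only [habs, Finset.sum_sub_distrib]
    rw [h1, h2]
    have h3 : ∑ x, ∑ v, sg v (x i) * r x = -∑ x, r x * centred (x i) := by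
      rw [← h1, ← Finset.sum_neg_distrib]
      refine Finset.sum_congr rfl fun x _ => ?_
      rw [← Finset.sum_neg_distrib]
      exact Finset.sum_congr rfl fun v _ => by rw [hanti]; ring
    linarith
  have hcs := Finset.sum_mul_sq_le_sq_mul_sq Finset.univ r fun x => ∑ i, centred (x i)
  have hr2 : ∑ x, r x ^ 2 ≤ k ^ 2 * (m : ℝ) ^ Fintype.card ι := by
    calc ∑ x, r x ^ 2 ≤ ∑ _x : ι → Fin m, k ^ 2 :=
          Finset.sum_le_sum fun x _ => pow_le_pow_left₀ (h0 x) (hk x) 2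
      _ = _ := by simp; ring
  have hmain : ∑ x, r x * ∑ i, centred (x i) ≤
      k * √(Fintype.card ι) * (m : ℝ) ^ (Fintype.card ι + 1) := by
    refine abs_le_of_sq_le_sq' ?_ (by positivity) |>.2
    calc _ ≤ _ := hcs
      _ ≤ (k ^ 2 * (m : ℝ) ^ Fintype.card ι) *
          (Fintype.card ι * (m : ℝ) ^ 2 * (m : ℝ) ^ Fintype.card ι) :=
        mul_le_mul hr2 (sum_sq_sum_centred_le m) (Finset.sum_nonneg fun _ _ => sq_nonneg _)
          (by positivity)
      _ = _ := by
        rw [mul_pow, mul_pow, Real.sq_sqrt (by positivity)]; ring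
  calc _ = 2 * ∑ x, r x * ∑ i, centred (x i) := by
        simp only [hi, ← Finset.mul_sum]
        rw [Finset.sum_comm]
        simp only [Finset.mul_sum]
    _ ≤ _ := by linarith

end Influence

/-! ### Fourier weights on product spaces -/

section Fourier

variable {ι V : Type} [Fintype ι] [DecidableEq ι] [Fintype V]

/-- There is an orthogonal basis of the functions on `V` that contains the constant `1`. -/
theorem exists_basis_with_one [DecidableEq V] (o : V) :
    ∃ u : V → V → ℝ, (∀ x, u o x = 1) ∧
      ∀ x y, ∑ a, u a x * u a y = if x = y then (Fintype.card V : ℝ) else 0 := by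
  have hV : (0 : ℝ) < Fintype.card V := by exact_mod_cast Fintype.card_pos_iff.2 ⟨o⟩
  -- The normalised constant vector is extended to an orthonormal basis, then rescaled by `√|V|`.
  set w : V → EuclideanSpace ℝ V := fun _ => WithLp.toLp 2 fun _ => (√(Fintype.card V))⁻¹ with hw
  have hon : Orthonormal ℝ (({o} : Set V).domRestrict w) := by
    refine ⟨fun i => ?_, fun i j hij => absurd (Subsingleton.elim i j) hij⟩
    simp only [Set.domRestrict_apply, hw, EuclideanSpace.norm_eq]
    simp [Real.sq_sqrt hV.le, hV.ne']
  obtain ⟨b, hb⟩ := hon.exists_orthonormalBasis_extension_of_card_eq (by simp)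
  refine ⟨fun a x => √(Fintype.card V) * b a x, fun x => ?_, fun x y => ?_⟩
  · simp only [hb o rfl, hw]
    exact mul_inv_cancel₀ (Real.sqrt_pos.2 hV).ne'
  · have h := b.sum_inner_mul_inner (EuclideanSpace.single x (1 : ℝ)) (EuclideanSpace.single y 1)
    simp only [EuclideanSpace.inner_single_left, EuclideanSpace.inner_single_right] at h
    have h2 : ∑ a, b a x * b a y = if x = y then 1 else 0 := by
      simpa [Pi.single_apply, eq_comm] using h
    calc _ = (√(Fintype.card V) * √(Fintype.card V)) * ∑ a, b a x * b a y := by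
          rw [Finset.mul_sum]; exact Finset.sum_congr rfl fun a _ => by ring
      _ = _ := by rw [h2, Real.mul_self_sqrt hV.le]; simp

/-- Fourier coefficient with respect to the product basis built from `u`. -/
def coeff (u : V → V → ℝ) (h : (ι → V) → ℝ) (α : ι → V) : ℝ := ∑ x, h x * ∏ i, u (α i) (x i)

/-- The product form of the index set lets the sum over `α` factor. Full factors give Parseval; a
single factor `{o}` isolates the weights that ignore one coordinate. -/
theorem sum_piFinset_coeff_sq (u : V → V → ℝ) (h : (ι → V) → ℝ) (t : ι → Finset V) :
    ∑ α ∈ Fintype.piFinset t, coeff u h α ^ 2 =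
      ∑ x, ∑ y, h x * h y * ∏ i, ∑ a ∈ t i, u a (x i) * u a (y i) := by
  simp_rw [Finset.prod_univ_sum, coeff, sq, Finset.sum_mul_sum, Finset.mul_sum]
  rw [Finset.sum_comm]
  refine Finset.sum_congr rfl fun x _ => ?_
  rw [Finset.sum_comm]
  refine Finset.sum_congr rfl fun y _ => Finset.sum_congr rfl fun α _ => ?_
  rw [Finset.prod_mul_distrib]; ring

variable [DecidableEq V] {u : V → V → ℝ} {o : V}

theorem sum_coeff_sq
    (hu : ∀ x y, ∑ a, u a x * u a y = if x = y then (Fintype.card V : ℝ) else 0)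
    (h : (ι → V) → ℝ) :
    ∑ α, coeff u h α ^ 2 = (Fintype.card V : ℝ) ^ Fintype.card ι * ∑ x, h x ^ 2 := by
  have := sum_piFinset_coeff_sq u h fun _ => Finset.univ
  rw [Fintype.piFinset_univ] at this
  rw [this, Finset.mul_sum]
  refine Finset.sum_congr rfl fun x _ => ?_
  rw [Finset.sum_eq_single x]
  · simp [hu]; ring
  · intro y _ hy
    obtain ⟨i, hi⟩ := Function.ne_iff.1 hy
    rw [Finset.prod_eq_zero (Finset.mem_univ i) (by rw [hu, if_neg (Ne.symm hi)]), mul_zero]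
  · simp

/-- In coordinate `i` the kernel is `1` instead of `|V|` times the diagonal, so `y` ranges over all
points that agree with `x` off `i`; the lost factor `|V|` reappears on the left. -/
theorem sum_coeff_sq_of_eq (hone : ∀ x, u o x = 1)
    (hu : ∀ x y, ∑ a, u a x * u a y = if x = y then (Fintype.card V : ℝ) else 0)
    (h : (ι → V) → ℝ) (i : ι) :
    Fintype.card V * ∑ α with α i = o, coeff u h α ^ 2 =
      (Fintype.card V : ℝ) ^ Fintype.card ι * ∑ x, ∑ v, h x * h (Function.update x i v) := by
  have hset : (Finset.univ.filter fun α : ι → V => α i = o) =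
      Fintype.piFinset (Function.update (fun _ => Finset.univ) i ({o} : Finset V)) := by
    ext α
    simp only [Finset.mem_filter, Finset.mem_univ, true_and, Fintype.mem_piFinset]
    constructor
    · intro h j
      rcases eq_or_ne j i with rfl | hj
      · simpa using h
      · simp [hj]
    · intro h
      simpa using h i
  rw [hset, sum_piFinset_coeff_sq, Finset.mul_sum, Finset.mul_sum]
  refine Finset.sum_congr rfl fun x _ => ?_
  have hinj : Function.Injective (Function.update x i) := Function.update_injective x i
  have hprod : ∀ y : ι → V, ∏ j, ∑ a ∈ Function.update (fun _ => (Finset.univ : Finset V)) i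
      ({o} : Finset V) j,
      u a (x j) * u a (y j) = ∏ j ∈ Finset.univ.erase i, if x j = y j then
        (Fintype.card V : ℝ) else 0 := by
    intro y
    rw [← Finset.mul_prod_erase _ _ (Finset.mem_univ i)]
    simp only [Function.update_self, Finset.sum_singleton, hone, one_mul, mul_one]
    refine Finset.prod_congr rfl fun j hj => ?_
    rw [Function.update_of_ne (Finset.ne_of_mem_erase hj), hu]
  simp only [hprod]
  have hsum : ∑ y, h x * h y * ∏ j ∈ Finset.univ.erase i, (if x j = y j then
      (Fintype.card V : ℝ) else 0) = ∑ v, h x * h (Function.update x i v) *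
        (Fintype.card V : ℝ) ^ (Fintype.card ι - 1) := by
    symm
    rw [← Finset.sum_subset (Finset.subset_univ (Finset.univ.image (Function.update x i))),
      Finset.sum_image hinj.injOn]
    · refine Finset.sum_congr rfl fun v _ => ?_
      rw [Finset.prod_congr rfl (g := fun _ => (Fintype.card V : ℝ))]
      · simp
      · intro j hj
        rw [Function.update_of_ne (Finset.ne_of_mem_erase hj), if_pos rfl]
    · intro y _ hy
      have : ∃ j ∈ Finset.univ.erase i, x j ≠ y j := by
        by_contra! hcon
        refine hy (Finset.mem_image.2 ⟨y i, Finset.mem_univ _, ?_⟩)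
        refine Function.update_eq_iff.2 ⟨rfl, fun j hj => hcon j ?_⟩
        simp [hj]
      obtain ⟨j, hj, hne⟩ := this
      rw [Finset.prod_eq_zero hj (if_neg hne), mul_zero]
  have hcard : 0 < Fintype.card ι := Fintype.card_pos_iff.2 ⟨i⟩
  rw [hsum, ← Finset.sum_mul, ← mul_assoc, mul_right_comm, ← pow_succ',
    Nat.sub_add_cancel hcard]

/-- The Fourier weights, counted with their degrees, sum up to the total influence. -/
theorem sum_degree_mul_coeff_sq (hone : ∀ x, u o x = 1)
    (hu : ∀ x y, ∑ a, u a x * u a y = if x = y then (Fintype.card V : ℝ) else 0)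
    (h : (ι → V) → ℝ) :
    2 * (Fintype.card V * ∑ α, ((Finset.univ.filter fun i => α i ≠ o).card : ℝ) * coeff u h α ^ 2) =
      (Fintype.card V : ℝ) ^ Fintype.card ι *
        ∑ i, ∑ x, ∑ v, (h x - h (Function.update x i v)) ^ 2 := by
  have h1 : ∀ i : ι, 2 * (Fintype.card V * ∑ α with α i ≠ o, coeff u h α ^ 2) =
      (Fintype.card V : ℝ) ^ Fintype.card ι * ∑ x, ∑ v, (h x - h (Function.update x i v)) ^ 2 := by
    intro i
    have ha := sum_coeff_sq_of_eq hone hu h i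
    have hb := sum_coeff_sq hu h
    rw [← Finset.sum_filter_add_sum_filter_not _ fun α => α i = o] at hb
    have hc := sum_sum_update_swap i fun x _ => h x ^ 2
    have hd : ∑ x, ∑ _v : V, h x ^ 2 = Fintype.card V * ∑ x, h x ^ 2 := by
      simp [Finset.mul_sum]
    -- Expanding the square, both pure terms equal `|V| ∑ h²` (Parseval), and the mixed term is the
    -- weight with `α i = o`.
    have he : ∑ x, ∑ v, (h x - h (Function.update x i v)) ^ 2 = ∑ x, ∑ _v : V, h x ^ 2 +
        ∑ x, ∑ v, h (Function.update x i v) ^ 2 -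
        2 * ∑ x, ∑ v, h x * h (Function.update x i v) := by
      simp only [Finset.mul_sum, ← Finset.sum_add_distrib, ← Finset.sum_sub_distrib]
      exact Finset.sum_congr rfl fun x _ => Finset.sum_congr rfl fun v _ => by ring
    rw [he, hc, hd]
    simp only [ne_eq]
    linear_combination 2 * (Fintype.card V : ℝ) * hb - 2 * ha
  rw [Finset.mul_sum (s := (Finset.univ : Finset ι)), ← Finset.sum_congr rfl fun i _ => h1 i,
    ← Finset.mul_sum, ← Finset.mul_sum]
  congr 2
  simp only [Finset.sum_filter]
  rw [Finset.sum_comm]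
  refine Finset.sum_congr rfl fun α _ => ?_
  rw [← Finset.sum_filter, Finset.sum_const, nsmul_eq_mul]

/-- The point `x` extends the partial assignment `p`. -/
def Extends (p : ι → Option V) (x : ι → V) : Prop := ∀ i, ∀ v, p i = some v → x i = v

open Classical in
-- The basis function of `α` depends only on the coordinates where `α i ≠ o`. It is constant on each
-- subgrid fixing these, and `h` sums to zero there.
theorem coeff_eq_zero_of_marginals (hone : ∀ x, u o x = 1) {h : (ι → V) → ℝ} {t : ℕ}
    (hmarg : ∀ p : ι → Option V, (Finset.univ.filter fun i => p i ≠ none).card ≤ t →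
      ∑ x with Extends p x, h x = 0)
    {α : ι → V} (hα : (Finset.univ.filter fun i => α i ≠ o).card ≤ t) : coeff u h α = 0 := by
  set φ : (ι → V) → ι → Option V := fun x i => if α i = o then none else some (x i) with hφ
  have hext : ∀ x y, φ y = φ x ↔ Extends (φ x) y := by
    intro x y
    simp only [hφ, Extends, funext_iff]
    refine forall_congr' fun i => ?_
    split_ifs <;> simp
  have hprod : ∀ x y, φ y = φ x → ∏ i, u (α i) (y i) = ∏ i, u (α i) (x i) := by
    intro x y hxy
    refine Finset.prod_congr rfl fun i _ => ?_
    by_cases hi : α i = o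
    · rw [hi, hone, hone]
    · have := congrFun hxy i
      simp only [hφ, hi, if_false, Option.some_inj] at this
      rw [this]
  rw [coeff, ← Finset.sum_fiberwise_of_maps_to (g := φ) (t := Finset.univ.image φ)
    fun x _ => Finset.mem_image_of_mem _ (Finset.mem_univ _)]
  refine Finset.sum_eq_zero fun p hp => ?_
  obtain ⟨x, -, rfl⟩ := Finset.mem_image.1 hp
  have hm := hmarg (φ x) (le_trans (Finset.card_le_card fun i => by simp [hφ]) hα)
  calc _ = ∑ y with φ y = φ x, h y * ∏ i, u (α i) (x i) :=
        Finset.sum_congr rfl fun y hy => by rw [hprod x y (Finset.mem_filter.1 hy).2]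
    _ = (∑ y with φ y = φ x, h y) * ∏ i, u (α i) (x i) := by rw [Finset.sum_mul]
    _ = 0 := by simp only [hext, hm, zero_mul]

open Classical in
/-- A function whose marginals of order at most `t` vanish has small norm if its total influence is
small. -/
theorem sum_sq_le_of_marginals {h : (ι → V) → ℝ} {t : ℕ}
    (hmarg : ∀ p : ι → Option V, (Finset.univ.filter fun i => p i ≠ none).card ≤ t →
      ∑ x with Extends p x, h x = 0) :
    2 * Fintype.card V * ((t + 1) * ∑ x, h x ^ 2) ≤
      ∑ i, ∑ x, ∑ v, (h x - h (Function.update x i v)) ^ 2 := by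
  rcases isEmpty_or_nonempty V with hV | ⟨⟨o⟩⟩
  · simp only [Fintype.card_eq_zero, Nat.cast_zero, mul_zero, zero_mul]
    positivity
  have hV : (0 : ℝ) < Fintype.card V := by exact_mod_cast Fintype.card_pos_iff.2 ⟨o⟩
  obtain ⟨u, hone, hu⟩ := exists_basis_with_one o
  have h1 := sum_degree_mul_coeff_sq hone hu h
  have h2 := sum_coeff_sq hu h
  have h3 : (t + 1) * ∑ α, coeff u h α ^ 2 ≤
      ∑ α, ((Finset.univ.filter fun i => α i ≠ o).card : ℝ) * coeff u h α ^ 2 := by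
    rw [Finset.mul_sum]
    refine Finset.sum_le_sum fun α _ => ?_
    rcases Nat.lt_or_ge t (Finset.univ.filter fun i => α i ≠ o).card with hα | hα
    · gcongr
      exact_mod_cast hα
    · simp [coeff_eq_zero_of_marginals hone hmarg hα]
  rw [h2] at h3
  have h4 := mul_le_mul_of_nonneg_left h3 (mul_pos two_pos hV).le
  rw [mul_assoc 2, mul_assoc 2, h1] at h4
  refine le_of_mul_le_mul_left ?_ (pow_pos hV (Fintype.card ι))
  linarith

end Fourier

/-! ### Coarsening to blocks -/

section Coarsening

theorem sum_comp_le_sum {α β : Type} [Fintype α] [Fintype β] {e : β → α}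
    (he : Function.Injective e) {F : α → ℝ} (hF : ∀ a, 0 ≤ F a) : ∑ b, F (e b) ≤ ∑ a, F a := by
  have h := Finset.sum_map Finset.univ ⟨e, he⟩ F
  exact h.symm.trans_le <|
    Finset.sum_le_sum_of_subset_of_nonneg (Finset.subset_univ _) fun a _ _ => hF a

theorem sum_le_sum_comp_add {α β : Type} [Fintype α] [Fintype β] {e : β → α}
    (he : Function.Injective e) {F : α → ℝ} {k : ℝ} (hF : ∀ a, F a ≤ k) :
    ∑ a, F a ≤ ∑ b, F (e b) + k * (Fintype.card α - Fintype.card β) := by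
  have h := sum_comp_le_sum he (F := fun a => k - F a) fun a => sub_nonneg.2 (hF a)
  simp only [Finset.sum_sub_distrib, Finset.sum_const, Finset.card_univ, nsmul_eq_mul] at h
  linarith

/-- A bounded function grows little, on average, in a diagonal step. -/
theorem sum_diagonal_step_le {m d : ℕ} {k : ℝ} (hk0 : 0 ≤ k) (H : (Fin d → ℕ) → ℝ)
    (h0 : ∀ a, 0 ≤ H a) (hk : ∀ a, H a ≤ k) :
    m * ∑ a : Grid m d, (H (fun i => a i + 1) - H (fun i => a i)) ≤ k * d * (m : ℝ) ^ d := by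
  cases m with
  | zero => simp; positivity
  | succ m =>
    -- The terms with `a + 1` inside the grid cancel against those with all coordinates positive. At
    -- most `(m + 1) ^ d - m ^ d` boundary terms remain, each at most `k`; Bernoulli bounds their
    -- number.
    have hup := sum_le_sum_comp_add (α := Grid (m + 1) d) (β := Grid m d)
      (e := fun b i => (b i).castSucc)
      (fun b c h => funext fun i => Fin.castSucc_injective m (congrFun h i))
      (F := fun a => H fun i => a i + 1) fun a => hk _
    have hlow := sum_comp_le_sum (α := Grid (m + 1) d) (β := Grid m d)
      (e := fun b i => (b i).succ)
      (fun b c h => funext fun i => Fin.succ_injective m (congrFun h i))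
      (F := fun a => H fun i => a i) fun a => h0 _
    simp only [Fin.val_castSucc, Fin.val_succ, Fintype.card_pi, Fintype.card_fin,
      Finset.prod_const, Finset.card_univ] at hup hlow
    have hbern := one_add_mul_le_pow (a := -(1 / ((m : ℝ) + 1))) (by
      have : 1 / ((m : ℝ) + 1) ≤ 1 := by
        rw [div_le_one (by positivity)]; linarith [(Nat.cast_nonneg m : (0 : ℝ) ≤ m)]
      linarith) d
    have hm : (0 : ℝ) < (m : ℝ) + 1 := by positivity
    have hpow : ((m : ℝ) + 1) ^ d * (1 + -(1 / ((m : ℝ) + 1))) ^ d = (m : ℝ) ^ d := by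
      rw [← mul_pow]; congr 1; field_simp; ring
    have hstep : ((m : ℝ) + 1) * (((m : ℝ) + 1) ^ d - (m : ℝ) ^ d) ≤ d * ((m : ℝ) + 1) ^ d := by
      have h1 := mul_le_mul_of_nonneg_left hbern (pow_pos hm d).le
      rw [hpow] at h1
      have h2 := mul_le_mul_of_nonneg_left h1 hm.le
      have h3 : ((m : ℝ) + 1) * (((m : ℝ) + 1) ^ d * (1 + d * -(1 / ((m : ℝ) + 1)))) =
          ((m : ℝ) + 1) ^ d * (m + 1 - d) := by field_simp; ring
      rw [h3] at h2
      linarith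
    rw [Finset.sum_sub_distrib]
    push_cast at hup ⊢
    calc ((m : ℝ) + 1) * _ ≤ (m + 1) * (k * (((m : ℝ) + 1) ^ d - (m : ℝ) ^ d)) := by
          gcongr; linarith
      _ = k * ((m + 1) * (((m : ℝ) + 1) ^ d - (m : ℝ) ^ d)) := by ring
      _ ≤ k * (d * ((m : ℝ) + 1) ^ d) := by gcongr
      _ = _ := by ring

variable {n m d : ℕ}

theorem corner_lt (hn : 0 < n) (a : Fin m) : (a : ℕ) * n / m < n :=
  Nat.div_lt_of_lt_mul (Nat.mul_lt_mul_of_pos_right a.2 hn)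

/-- The restriction of `g` to the lower corners of the `m ^ d` blocks of `[n]^d`. -/
def coarse (hn : 0 < n) (m : ℕ) (g : Grid n d → Bool) : Grid m d → Bool :=
  fun a => g fun i => ⟨a i * n / m, corner_lt hn (a i)⟩

theorem KMonotone.coarse (hn : 0 < n) {k : ℕ} {g : Grid n d → Bool} (hg : KMonotone k g) :
    KMonotone k (coarse hn m g) :=
  hg.comp (e := fun (a : Grid m d) i => ⟨a i * n / m, corner_lt hn (a i)⟩) fun _ _ h i =>
    Nat.div_le_div_right (Nat.mul_le_mul_right n (h i))

/-- The projection of the common refinement `[n * m]^d` to `[n]^d`. -/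
def toPoint (y : Grid (n * m) d) : Grid n d := fun i => (y i).divNat

/-- The block of a point of the refinement `[n * m]^d`. -/
def toBlock (y : Grid (n * m) d) : Grid m d := fun i => ((y i).cast (mul_comm n m)).divNat

theorem sum_toPoint (F : Grid n d → ℝ) :
    ∑ y : Grid (n * m) d, F (toPoint y) = (m : ℝ) ^ d * ∑ x, F x := by
  have h := Fintype.sum_equiv ((Equiv.arrowCongr (Equiv.refl (Fin d)) finProdFinEquiv.symm).trans
    (Equiv.arrowProdEquivProdArrow (Fin d) (fun _ => Fin n) fun _ => Fin m))
    (fun y => F (toPoint y)) (fun z => F z.1) fun y => rfl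
  rw [h, Fintype.sum_prod_type]
  simp [Finset.mul_sum]

theorem sum_toBlock (F : Grid m d → ℝ) :
    ∑ y : Grid (n * m) d, F (toBlock y) = (n : ℝ) ^ d * ∑ a, F a := by
  have h := Fintype.sum_equiv (Equiv.arrowCongr (Equiv.refl (Fin d)) (finCongr (mul_comm n m)))
    (fun y => F (toBlock y)) (fun z : Grid (m * n) d => F (toPoint z)) fun y => rfl
  rw [h, sum_toPoint]

/-- `coarse g`, read blockwise, differs from a `k`-monotone `g` on a small part of the domain. -/
theorem sum_ne_coarse_le (hn : 0 < n) {k : ℕ} {g : Grid n d → Bool} (hg : KMonotone k g) :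
    m * ∑ y : Grid (n * m) d,
        (if g (toPoint y) ≠ coarse hn m g (toBlock y) then (1 : ℝ) else 0) ≤
      k * d * ((n : ℝ) ^ d * (m : ℝ) ^ d) := by
  classical
  obtain ⟨r, hr, hrk, hgr⟩ := hg.exists_rank
  -- The value `k` outside the grid keeps the extended rank monotone and bounded, so the next corner
  -- may leave the grid.
  set G : (Fin d → ℕ) → ℝ := fun u =>
    if h : ∀ i, u i < n then (r fun i => ⟨u i, h i⟩ : ℝ) else k with hG
  have hG0 : ∀ u, 0 ≤ G u := fun u => by
    simp only [hG]; split_ifs <;> positivity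
  have hGk : ∀ u, G u ≤ k := fun u => by
    simp only [hG]; split_ifs
    · exact_mod_cast hrk _
    · exact le_rfl
  have hGm : Monotone G := fun u v huv => by
    by_cases hv : ∀ i, v i < n
    · have hu : ∀ i, u i < n := fun i => (huv i).trans_lt (hv i)
      simp only [hG, dif_pos hu, dif_pos hv, Nat.cast_le]
      exact hr fun i => huv i
    · exact (hGk u).trans_eq (by simp only [hG, dif_neg hv])
  set H : (Fin d → ℕ) → ℝ := fun a => G fun i => a i * n / m with hH
  have hstep := sum_diagonal_step_le (m := m) (Nat.cast_nonneg k) H (fun a => hG0 _) fun a => hGk _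
  -- The point lies between the corner of its block and the diagonally next corner, so its rank does
  -- too. The refinement avoids assuming that `m` divides `n`.
  have hpt : ∀ y : Grid (n * m) d,
      (if g (toPoint y) ≠ coarse hn m g (toBlock y) then (1 : ℝ) else 0) ≤
        H (fun i => toBlock y i + 1) - H (fun i => toBlock y i) := by
    intro y
    have hp : (r (toPoint y) : ℝ) = G fun i => y i / m := by
      have h : ∀ i, (y i : ℕ) / m < n := fun i => (toPoint y i).2
      simp only [hG, dif_pos h]
      rfl
    have hc : (r fun i => ⟨toBlock y i * n / m, corner_lt hn (toBlock y i)⟩ : ℝ) =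
        H fun i => toBlock y i := by
      simp only [hH, hG, dif_pos fun i => corner_lt hn (toBlock y i)]
    have h1 : (H fun i => toBlock y i) ≤ G fun i => y i / m :=
      hGm fun i => Nat.div_le_div_right (Nat.div_mul_le_self (y i) n)
    have h2 : (G fun i => y i / m) ≤ H fun i => toBlock y i + 1 :=
      hGm fun i => Nat.div_le_div_right (by
        have := Nat.lt_div_mul_add (a := (y i : ℕ)) hn
        change (y i : ℕ) ≤ ((y i : ℕ) / n + 1) * n
        rw [add_mul, one_mul]; exact this.le)
    refine (card_ne_le_of_rank hgr).trans ?_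
    rw [hp, hc, abs_of_nonneg (sub_nonneg.2 h1)]
    linarith
  calc _ ≤ (m : ℝ) * ∑ y : Grid (n * m) d,
        (H (fun i => toBlock y i + 1) - H (fun i => toBlock y i)) := by
        gcongr with y; exact hpt y
    _ = (n : ℝ) ^ d * (m * ∑ a : Grid m d, (H (fun i => a i + 1) - H (fun i => a i))) := by
        rw [sum_toBlock fun a : Grid m d => H (fun i => a i + 1) - H (fun i => a i)]; ring
    _ ≤ (n : ℝ) ^ d * (k * d * (m : ℝ) ^ d) := by gcongr
    _ = _ := by ring

/-- Triangle inequality on the common refinement; each passage to a coarse function costs `k * d /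
m`. -/
theorem relDist_le_coarse (hn : 0 < n) (hm : 0 < m) {k : ℕ} {f g : Grid n d → Bool}
    (hf : KMonotone k f) (hg : KMonotone k g) :
    relDist f g ≤ 2 * (k * d / m) + relDist (coarse hn m f) (coarse hn m g) := by
  have hn' : (0 : ℝ) < n := by exact_mod_cast hn
  have hm' : (0 : ℝ) < m := by exact_mod_cast hm
  have h1 := sum_ne_coarse_le (m := m) hn hf
  have h2 := sum_ne_coarse_le (m := m) hn hg
  have h3 := sum_toPoint (m := m) fun x => if f x ≠ g x then (1 : ℝ) else 0
  have h4 := sum_toBlock (n := n) fun a : Grid m d =>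
    if coarse hn m f a ≠ coarse hn m g a then (1 : ℝ) else 0
  have h5 : ∑ y : Grid (n * m) d, (if f (toPoint y) ≠ g (toPoint y) then (1 : ℝ) else 0) ≤
      ∑ y : Grid (n * m) d, (if f (toPoint y) ≠ coarse hn m f (toBlock y) then (1 : ℝ) else 0) +
      ∑ y : Grid (n * m) d, (if g (toPoint y) ≠ coarse hn m g (toBlock y) then (1 : ℝ) else 0) +
      ∑ y : Grid (n * m) d,
        (if coarse hn m f (toBlock y) ≠ coarse hn m g (toBlock y) then (1 : ℝ) else 0) := by
    rw [← Finset.sum_add_distrib, ← Finset.sum_add_distrib]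
    refine Finset.sum_le_sum fun y _ => ?_
    cases f (toPoint y) <;> cases g (toPoint y) <;> cases coarse hn m f (toBlock y) <;>
      cases coarse hn m g (toBlock y) <;> norm_num
  rw [h3, h4] at h5
  rw [relDist_eq, relDist_eq]
  simp only [Fintype.card_pi, Fintype.card_fin, Finset.prod_const, Finset.card_univ, Nat.cast_pow]
  set A := ∑ x : Grid n d, if f x ≠ g x then (1 : ℝ) else 0
  set B := ∑ a : Grid m d, if coarse hn m f a ≠ coarse hn m g a then (1 : ℝ) else 0
  rw [div_le_iff₀ (by positivity)]
  have h6 : (m : ℝ) ^ (d + 1) * A ≤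
      (m : ℝ) ^ (d + 1) * ((2 * (k * d / m) + B / (m : ℝ) ^ d) * (n : ℝ) ^ d) := by
    have h7 := mul_le_mul_of_nonneg_left h5 hm'.le
    calc (m : ℝ) ^ (d + 1) * A = m * ((m : ℝ) ^ d * A) := by ring
      _ ≤ _ := h7
      _ ≤ 2 * (k * d * ((n : ℝ) ^ d * (m : ℝ) ^ d)) + m * ((n : ℝ) ^ d * B) := by
          rw [mul_add, mul_add]; linarith
      _ = _ := by field_simp; ring
  exact le_of_mul_le_mul_left h6 (by positivity)

end Coarsening

/-! ### Low-order marginals as a signature -/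

section Marginals

open Classical in
/-- The low-order marginals of a `k`-monotone function determine it up to a small distance. -/
theorem relDist_le_of_marginals {m d k t : ℕ} (hm : 0 < m) {f g : Grid m d → Bool}
    (hf : KMonotone k f) (hg : KMonotone k g)
    (h : ∀ p : Fin d → Option (Fin m), (Finset.univ.filter fun i => p i ≠ none).card ≤ t →
      (Finset.univ.filter fun x => f x = true ∧ Extends p x).card =
        (Finset.univ.filter fun x => g x = true ∧ Extends p x).card) :
    relDist f g ≤ 4 * (k * √d) / (t + 1) := by
  have hm' : (0 : ℝ) < m := by exact_mod_cast hm
  obtain ⟨r, hr, hrk, hfr⟩ := hf.exists_rank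
  obtain ⟨r', hr', hrk', hgr⟩ := hg.exists_rank
  set δ : Grid m d → ℝ := fun x => (if f x = true then 1 else 0) - if g x = true then 1 else 0
    with hδ
  have hmarg : ∀ p : Fin d → Option (Fin m), (Finset.univ.filter fun i => p i ≠ none).card ≤ t →
      ∑ x with Extends p x, δ x = 0 := by
    intro p hp
    simp only [hδ, Finset.sum_sub_distrib, Finset.sum_boole, Finset.filter_filter]
    rw [sub_eq_zero, Nat.cast_inj]
    simpa only [and_comm] using h p hp
  have h1 := sum_sq_le_of_marginals hmarg
  have hinf : ∀ {r : Grid m d → ℕ}, Monotone r → (∀ x, r x ≤ k) →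
      ∑ i, ∑ x, ∑ v, |(r x : ℝ) - r (Function.update x i v)| ≤
        2 * k * √d * (m : ℝ) ^ (d + 1) := fun {r} hr hrk => by
    simpa using sum_abs_sub_update_le (r := fun x => (r x : ℝ)) (k := k)
      (fun x y hxy => Nat.cast_le.2 (hr hxy)) (fun x => Nat.cast_nonneg _)
      (fun x => by exact_mod_cast hrk x) (Nat.cast_nonneg k)
  -- This is `(a - b)² ≤ 2 (a² + b²)` for the increments of `f` and `g`, each bounded by the
  -- increment of its rank.
  have h2 : ∑ i, ∑ x, ∑ v, (δ x - δ (Function.update x i v)) ^ 2 ≤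
      2 * (∑ i, ∑ x, ∑ v, |(r x : ℝ) - r (Function.update x i v)| +
        ∑ i, ∑ x, ∑ v, |(r' x : ℝ) - r' (Function.update x i v)|) := by
    simp only [Finset.mul_sum, ← Finset.sum_add_distrib]
    refine Finset.sum_le_sum fun i _ => Finset.sum_le_sum fun x _ => Finset.sum_le_sum fun v _ => ?_
    have ha := card_ne_le_of_rank hfr (x := x) (y := Function.update x i v)
    have hb := card_ne_le_of_rank hgr (x := x) (y := Function.update x i v)
    refine le_trans ?_ (mul_le_mul_of_nonneg_left (add_le_add ha hb) two_pos.le)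
    simp only [hδ]
    cases f x <;> cases g x <;> cases f (Function.update x i v) <;>
      cases g (Function.update x i v) <;> norm_num
  have h3 : ∑ x, δ x ^ 2 = relDist f g * (m : ℝ) ^ d := by
    rw [relDist_eq]
    simp only [Fintype.card_pi, Fintype.card_fin, Finset.prod_const, Finset.card_univ,
      Nat.cast_pow]
    rw [div_mul_cancel₀ _ (pow_pos hm' d).ne']
    refine Finset.sum_congr rfl fun x _ => ?_
    simp only [hδ]
    cases f x <;> cases g x <;> norm_num
  rw [h3, Fintype.card_fin] at h1
  have h4 := h1.trans h2
  have h5 := hinf hr hrk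
  have h6 := hinf hr' hrk'
  rw [le_div_iff₀ (by positivity)]
  have h7 : (2 * (m : ℝ) ^ (d + 1)) * (relDist f g * (t + 1)) ≤
      (2 * (m : ℝ) ^ (d + 1)) * (4 * (k * √d)) := by
    rw [pow_succ] at *
    linarith
  exact le_of_mul_le_mul_left h7 (by positivity)

/-- There are few assignments with small support. -/
theorem card_support_le {ι W : Type} [Fintype ι] [DecidableEq ι] [Nonempty ι] [Fintype W]
    [DecidableEq W] (o : W) (t : ℕ) :
    (Finset.univ.filter fun p : ι → W => (Finset.univ.filter fun i => p i ≠ o).card ≤ t).card ≤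
      (Fintype.card ι * Fintype.card W) ^ t := by
  induction t with
  | zero =>
    rw [pow_zero, Finset.card_le_one]
    intro p hp q hq
    simp only [Finset.mem_filter, Finset.mem_univ, true_and, nonpos_iff_eq_zero,
      Finset.card_eq_zero, Finset.filter_eq_empty_iff, not_not, forall_const] at hp hq
    funext i
    rw [hp, hq]
  | succ t ih =>
    set A := Finset.univ.filter fun p : ι → W => (Finset.univ.filter fun i => p i ≠ o).card ≤ t
    calc _ ≤ ((A ×ˢ (Finset.univ : Finset (ι × W))).image
          fun z => Function.update z.1 z.2.1 z.2.2).card := by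
          refine Finset.card_le_card fun p hp => ?_
          simp only [Finset.mem_filter, Finset.mem_univ, true_and] at hp
          -- Resetting one support coordinate to `o` lowers the support size; if the support is
          -- empty, any `i` serves.
          obtain ⟨i, hi⟩ : ∃ i, (Finset.univ.filter fun i => p i ≠ o) ⊆ {i} ∨ p i ≠ o := by
            by_cases h : ∃ i, p i ≠ o
            · exact h.imp fun i hi => Or.inr hi
            · push Not at h
              exact ⟨Classical.arbitrary ι, Or.inl (by simp [h])⟩
          refine Finset.mem_image.2 ⟨(Function.update p i o, i, p i), ?_, by simp⟩
          simp only [A, Finset.mem_product, Finset.mem_filter, Finset.mem_univ, true_and, and_true]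
          have hsub : (Finset.univ.filter fun j => Function.update p i o j ≠ o) ⊆
              (Finset.univ.filter fun j => p j ≠ o).erase i := by
            intro j hj
            rcases eq_or_ne j i with rfl | hji
            · simp at hj
            · simpa [hji] using hj
          refine (Finset.card_le_card hsub).trans ?_
          rcases hi with hi | hi
          · have : (Finset.univ.filter fun j => p j ≠ o).erase i = ∅ := by
              rw [Finset.erase_eq_empty_iff]
              exact Or.symm (Finset.subset_singleton_iff.1 hi).symm
            simp [this]
          · rw [Finset.card_erase_of_mem (by simpa using hi)]
            omega
      _ ≤ A.card * (Fintype.card ι * Fintype.card W) := by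
          refine Finset.card_image_le.trans ?_
          rw [Finset.card_product, Finset.card_univ, Fintype.card_prod]
      _ ≤ _ := by
          rw [pow_succ]
          gcongr

end Marginals

/-! ### The two testers and their query counts -/

section Testers

/-- The tester that accepts without asking anything. -/
noncomputable def acceptTester (X : Type) : NonadaptiveTester X :=
  ⟨Unit, PMF.pure (), fun _ => [], fun _ _ => true⟩

theorem acceptTester_output {X : Type} (f : X → Bool) : (acceptTester X).output f true = 1 := by
  rw [NonadaptiveTester.output, acceptTester, PMF.pure_map, PMF.pure_apply]
  simp [NonadaptiveTester.run]

theorem exists_tester_fullRange {p : Params} (hp : p ∈ fullRange) :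
    ∃ (T : NonadaptiveTester (Grid p.n p.d)) (s : ℕ), T.MakesAtMost s ∧
      T.IsTolerantTester (kMonotoneProperty (Grid p.n p.d) p.k) p.ε₁ p.ε₂ ∧
      (s : ℝ) ≤ 193 * (1 / (p.ε₂ - p.ε₁) ^ 2 * (5 * p.k * p.d / (p.ε₂ - p.ε₁)) ^ p.d) := by
  obtain ⟨n, d, k, ε₁, ε₂⟩ := p
  obtain ⟨hn, hd, hk, h0, hlt, h1⟩ := hp
  dsimp only at *
  set δ := ε₂ - ε₁ with hδ
  have hδ0 : 0 < δ := sub_pos.2 hlt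
  have hδ1 : δ ≤ 1 := by linarith
  have hd' : (1 : ℝ) ≤ d := by exact_mod_cast hd
  have hk' : (1 : ℝ) ≤ k := by exact_mod_cast hk
  have hkd : (1 : ℝ) ≤ k * d / δ := by
    rw [le_div_iff₀ hδ0]; nlinarith
  have : Nonempty (Fin n) := ⟨⟨0, hn⟩⟩
  -- The factor `4` makes the coarsening error `2 k d / m` at most `δ / 2`; rounding up turns it
  -- into the `5` of the statement.
  set m := ⌈4 * (k * d / δ)⌉₊ with hm
  have hmlow : 4 * (k * d / δ) ≤ m := Nat.le_ceil _
  have hmup : (m : ℝ) ≤ 5 * k * d / δ := by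
    have := (Nat.ceil_lt_add_one (show 0 ≤ 4 * (k * d / δ) by positivity)).le
    calc (m : ℝ) ≤ 4 * (k * d / δ) + 1 := this
      _ ≤ 4 * (k * d / δ) + k * d / δ := by gcongr
      _ = _ := by ring
  have hm1 : (1 : ℝ) ≤ m := by linarith
  have hm0 : 0 < m := by exact_mod_cast hm1
  have hdist : 2 * (k * d / m : ℝ) ≤ δ / 2 := by
    have h4 : (k : ℝ) * d / m ≤ δ / 4 := by
      rw [div_le_div_iff₀ (by linarith) (by norm_num)]
      rw [← mul_div_assoc, div_le_iff₀ hδ0] at hmlow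
      linarith
    linarith
  set s := ⌈64 * (Real.log (Fintype.card (Grid m d → Bool)) + Real.log 3) / δ ^ 2⌉₊ with hs
  obtain ⟨T, hT, hT'⟩ := exists_tester_of_signature (P := kMonotoneProperty (Grid n d) k)
    ⟨_, show KMonotone k _ from kMonotone_const hk false⟩ (coarse hn m) hlt hδ1
    (fun f hf g hg hfg => by
      have := relDist_le_coarse hn hm0 hf hg
      rw [hfg, show relDist (coarse hn m g) (coarse hn m g) = 0 by simp [relDist], add_zero] at this
      exact this.trans hdist) (s := s) (Nat.le_ceil _)
  refine ⟨T, s, hT, hT', ?_⟩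
  have hlog : Real.log (Fintype.card (Grid m d → Bool)) + Real.log 3 ≤ (m : ℝ) ^ d + 2 := by
    have h3 := Real.log_le_sub_one_of_pos (show (0 : ℝ) < 3 by norm_num)
    have h2 := Real.log_le_sub_one_of_pos (show (0 : ℝ) < 2 by norm_num)
    have : Real.log (Fintype.card (Grid m d → Bool)) = (m : ℝ) ^ d * Real.log 2 := by simp
    rw [this]
    have := mul_le_mul_of_nonneg_left h2 (show 0 ≤ (m : ℝ) ^ d by positivity)
    linarith
  have hA : 1 ≤ (m : ℝ) ^ d := one_le_pow₀ hm1
  have hδ2 : 1 ≤ 1 / δ ^ 2 := by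
    rw [le_div_iff₀ (by positivity), one_mul]; exact pow_le_one₀ hδ0.le hδ1
  have hlog0 : 0 ≤ Real.log (Fintype.card (Grid m d → Bool)) + Real.log 3 :=
    add_nonneg (Real.log_natCast_nonneg _) (Real.log_nonneg (by norm_num))
  calc (s : ℝ) ≤ 64 * (Real.log (Fintype.card (Grid m d → Bool)) + Real.log 3) / δ ^ 2 + 1 :=
        (Nat.ceil_lt_add_one (by positivity)).le
    _ ≤ 64 * ((m : ℝ) ^ d + 2) / δ ^ 2 + 1 := by gcongr
    _ ≤ 64 * ((m : ℝ) ^ d + 2 * (m : ℝ) ^ d) / δ ^ 2 + 1 / δ ^ 2 * (m : ℝ) ^ d := by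
        gcongr
        · linarith
        · nlinarith
    _ = 193 * (1 / δ ^ 2 * (m : ℝ) ^ d) := by ring
    _ ≤ _ := by gcongr

open Classical in
/-- Tester whose signature is the table of low-order marginals of the coarsened function. -/
theorem exists_tester_of_marginals {n d k : ℕ} {ε₁ ε₂ : ℝ} (hn : 0 < n) (hd : 0 < d) (hk : 0 < k)
    (hlt : ε₁ < ε₂) (hδ1 : ε₂ - ε₁ ≤ 1) {m t : ℕ} (hm : 8 * (k * d / (ε₂ - ε₁)) ≤ m)
    (ht : 16 * (k * √d / (ε₂ - ε₁)) ≤ t) :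
    ∃ (T : NonadaptiveTester (Grid n d)) (s : ℕ), T.MakesAtMost s ∧
      T.IsTolerantTester (kMonotoneProperty (Grid n d) k) ε₁ ε₂ ∧
      (s : ℝ) ≤ (d * (m + 1) : ℝ) ^ (t + 4) := by
  set δ := ε₂ - ε₁ with hδ
  have hδ0 : 0 < δ := sub_pos.2 hlt
  have hd' : (1 : ℝ) ≤ d := by exact_mod_cast hd
  have hk' : (1 : ℝ) ≤ k := by exact_mod_cast hk
  have hkd : 1 / δ ≤ k * d / δ := by gcongr; nlinarith
  have hm8 : 8 / δ ≤ m := by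
    refine le_trans ?_ hm
    rw [show 8 / δ = 8 * (1 / δ) by ring]; gcongr
  have h8 : 8 ≤ 8 / δ := by rw [le_div_iff₀ hδ0]; linarith
  have hm0 : 0 < m := by
    have : (0 : ℝ) < m := by linarith
    exact_mod_cast this
  have : Nonempty (Fin n) := ⟨⟨0, hn⟩⟩
  have : Nonempty (Fin d) := ⟨⟨0, hd⟩⟩
  -- The budget `δ / 2` is split equally: `m ≥ 8 k d / δ` pays for coarsening, `t ≥ 16 k √d / δ` for
  -- the marginals.
  have hdist : ∀ f ∈ kMonotoneProperty (Grid n d) k, ∀ g ∈ kMonotoneProperty (Grid n d) k,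
      relDist (coarse hn m f) (coarse hn m g) ≤ δ / 4 → relDist f g ≤ δ / 2 := by
    intro f hf g hg hfg
    have h1 := relDist_le_coarse hn hm0 hf hg
    have h4 : (k : ℝ) * d / m ≤ δ / 8 := by
      rw [div_le_div_iff₀ (by linarith) (by norm_num)]
      rw [← mul_div_assoc, div_le_iff₀ hδ0] at hm
      linarith
    linarith
  set A := {p : Fin d → Option (Fin m) // (Finset.univ.filter fun i => p i ≠ none).card ≤ t}
  have hA : Fintype.card A ≤ (d * (m + 1)) ^ t := by
    rw [Fintype.card_subtype]
    simpa using card_support_le (ι := Fin d) (none : Option (Fin m)) t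
  set σ : (Grid n d → Bool) → A → Fin (m ^ d + 1) := fun f p =>
    ⟨(Finset.univ.filter fun x => coarse hn m f x = true ∧ Extends p.1 x).card,
      Nat.lt_succ_of_le ((Finset.card_le_univ _).trans_eq (by simp))⟩ with hσ
  set s := ⌈64 * (Real.log (Fintype.card (A → Fin (m ^ d + 1))) + Real.log 3) / δ ^ 2⌉₊ with hs
  obtain ⟨T, hT, hT'⟩ := exists_tester_of_signature (P := kMonotoneProperty (Grid n d) k)
    ⟨_, show KMonotone k _ from kMonotone_const hk false⟩ σ hlt hδ1
    (fun f hf g hg hfg => by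
      refine hdist f hf g hg ((relDist_le_of_marginals hm0 (KMonotone.coarse hn hf)
        (KMonotone.coarse hn hg) (t := t) fun p hp =>
          Fin.mk.inj_iff.1 (congrFun hfg ⟨p, hp⟩)).trans ?_)
      rw [div_le_div_iff₀ (by positivity) (by norm_num)]
      rw [← mul_div_assoc, div_le_iff₀ hδ0] at ht
      linarith) (s := s) (Nat.le_ceil _)
  refine ⟨T, s, hT, hT', ?_⟩
  set M : ℝ := d * (m + 1) with hM
  have hMm : (m : ℝ) + 1 ≤ M := by
    rw [hM]; exact le_mul_of_one_le_left (by positivity) hd'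
  have hM8 : 8 / δ ≤ M := by linarith
  have hM1 : 8 ≤ M := by linarith
  have hlogm : Real.log ((m : ℝ) ^ d + 1) ≤ M := by
    have h1 : (m : ℝ) ^ d + 1 ≤ ((m : ℝ) + 1) ^ d := by
      simpa using pow_add_pow_le (x := (m : ℝ)) (y := 1) (by positivity) (by norm_num) hd.ne'
    calc Real.log ((m : ℝ) ^ d + 1) ≤ Real.log (((m : ℝ) + 1) ^ d) :=
          Real.log_le_log (by positivity) h1
      _ = d * Real.log ((m : ℝ) + 1) := Real.log_pow _ _
      _ ≤ d * ((m : ℝ) + 1) := by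
          gcongr
          have := Real.log_le_sub_one_of_pos (show (0 : ℝ) < (m : ℝ) + 1 by positivity)
          linarith
  have hlog : Real.log (Fintype.card (A → Fin (m ^ d + 1))) ≤ M ^ (t + 1) := by
    have h1 : Real.log (Fintype.card (A → Fin (m ^ d + 1))) =
        Fintype.card A * Real.log ((m : ℝ) ^ d + 1) := by
      rw [Fintype.card_fun, Fintype.card_fin]; push_cast; rw [Real.log_pow]
    have h2 : (Fintype.card A : ℝ) ≤ M ^ t := by rw [hM]; exact_mod_cast hA
    rw [h1, pow_succ]
    exact mul_le_mul h2 hlogm (Real.log_nonneg (by simp)) (by positivity)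
  have hlog0 : 0 ≤ Real.log (Fintype.card (A → Fin (m ^ d + 1))) + Real.log 3 :=
    add_nonneg (Real.log_natCast_nonneg _) (Real.log_nonneg (by norm_num))
  have h3 := Real.log_le_sub_one_of_pos (show (0 : ℝ) < 3 by norm_num)
  have hB : 1 ≤ M ^ (t + 1) := one_le_pow₀ (by linarith)
  have hM2 : 64 / δ ^ 2 ≤ M ^ 2 := by
    calc 64 / δ ^ 2 = (8 / δ) ^ 2 := by ring_nf
      _ ≤ _ := by gcongr
  have hM21 : 1 ≤ M ^ 2 := one_le_pow₀ (by linarith)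
  calc (s : ℝ) ≤ 64 * (Real.log (Fintype.card (A → Fin (m ^ d + 1))) + Real.log 3) / δ ^ 2 + 1 :=
        (Nat.ceil_lt_add_one (by positivity)).le
    _ = 64 / δ ^ 2 * (Real.log (Fintype.card (A → Fin (m ^ d + 1))) + Real.log 3) + 1 := by ring
    _ ≤ M ^ 2 * (M ^ (t + 1) + 2 * M ^ (t + 1)) + M ^ 2 * M ^ (t + 1) := by
        gcongr
        · linarith
        · nlinarith
    _ = 4 * M ^ (t + 3) := by ring
    _ ≤ M * M ^ (t + 3) := by gcongr; linarith
    _ = M ^ (t + 4) := by ring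

theorem exists_tester_restrictedRange {p : Params} (hp : p ∈ restrictedRange) :
    ∃ (T : NonadaptiveTester (Grid p.n p.d)) (s : ℕ), T.MakesAtMost s ∧
      T.IsTolerantTester (kMonotoneProperty (Grid p.n p.d) p.k) p.ε₁ p.ε₂ ∧
      (s : ℝ) ≤ (2 : ℝ) ^ (126 * (p.k * √p.d / (p.ε₂ - 3 * p.ε₁) ^ 2 *
        Real.logb 2 (p.k * √p.d / (p.ε₂ - 3 * p.ε₁) ^ 2) ^ 1)) := by
  obtain ⟨n, d, k, ε₁, ε₂⟩ := p
  obtain ⟨⟨hn, hd, hk, h0, hlt, h1⟩, h3⟩ := hp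
  dsimp only at *
  have : Nonempty (Fin n) := ⟨⟨0, hn⟩⟩
  -- For `ε₂ > 1 / 2` nothing has to be rejected. Otherwise `F ≥ 4`, so that `log F` cannot
  -- degenerate and powers of `F` absorb the constants.
  rcases lt_or_ge (1 / 2) ε₂ with hε | hε
  · refine ⟨acceptTester _, 0, fun _ => le_rfl, ⟨fun f _ => ?_, fun f hf => ?_⟩, ?_⟩
    · rw [acceptTester_output]
      exact ENNReal.div_le_of_le_mul (by norm_num)
    · exact absurd (hf.trans (distTo_kMonotone_le_half hk f)) (not_le.2 hε)
    · simp only [Nat.cast_zero]; positivity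
  set δ := ε₂ - ε₁ with hδ
  set η := ε₂ - 3 * ε₁ with hη
  have hη0 : 0 < η := sub_pos.2 h3
  have hηδ : η ≤ δ := by linarith
  have hδ0 : 0 < δ := by linarith
  have hδ2 : δ ≤ 1 / 2 := by linarith
  have hd' : (1 : ℝ) ≤ d := by exact_mod_cast hd
  have hk' : (1 : ℝ) ≤ k := by exact_mod_cast hk
  have hsd : 1 ≤ √(d : ℝ) := Real.one_le_sqrt.2 hd'
  set F := k * √d / η ^ 2 with hF
  set z := 1 / δ with hz
  have hz2 : 2 ≤ z := by rw [hz, le_div_iff₀ hδ0]; linarith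
  have hFz : k * √d * z ^ 2 ≤ F := by
    rw [hF, hz, one_div, inv_pow, ← div_eq_mul_inv]
    gcongr
  have hks : 1 ≤ k * √(d : ℝ) := by nlinarith
  have hz4 : 4 ≤ z ^ 2 := by nlinarith
  have hF4 : 4 ≤ F := by nlinarith
  set m := ⌈8 * (k * d / δ)⌉₊ with hm
  set t := ⌈16 * (k * √d / δ)⌉₊ with ht
  obtain ⟨T, s, hT, hT', hs⟩ := exists_tester_of_marginals hn hd hk hlt (by linarith)
    (Nat.le_ceil (8 * (k * d / (ε₂ - ε₁)))) (Nat.le_ceil (16 * (k * √d / (ε₂ - ε₁))))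
  refine ⟨T, s, hT, hT', hs.trans ?_⟩
  have hmup : (m : ℝ) ≤ 8 * (k * d / δ) + 1 := (Nat.ceil_lt_add_one (by positivity)).le
  have htup : (t : ℝ) ≤ 16 * (k * √d / δ) + 1 := (Nat.ceil_lt_add_one (by positivity)).le
  have hkz : k * √d / δ = k * √d * z := by rw [hz]; ring
  have ht21 : ((t + 4 : ℕ) : ℝ) ≤ 21 * F := by
    push_cast
    have : k * √d * z ≤ k * √d * z ^ 2 := by gcongr; nlinarith
    rw [hkz] at htup
    linarith
  have hMup : (d : ℝ) * (m + 1) ≤ F ^ 6 := by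
    have hdd : (d : ℝ) = √d ^ 2 := (Real.sq_sqrt (by positivity)).symm
    have hkd1 : 1 ≤ k * (d : ℝ) * z := by
      have : 1 ≤ k * (d : ℝ) := by nlinarith
      nlinarith
    have ha : (d : ℝ) * (m + 1) ≤ 10 * (k * d ^ 2 * z) := by
      have : (m : ℝ) + 1 ≤ 10 * (k * d * z) := by
        have : k * (d : ℝ) / δ = k * d * z := by rw [hz]; ring
        rw [this] at hmup
        linarith
      calc (d : ℝ) * (m + 1) ≤ d * (10 * (k * d * z)) := by gcongr
        _ = _ := by ring
    have hb : k * (d : ℝ) ^ 2 * z ≤ F ^ 4 := by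
      calc k * (d : ℝ) ^ 2 * z ≤ (k : ℝ) ^ 4 * (d : ℝ) ^ 2 * z ^ 8 := by
            gcongr
            · exact le_self_pow₀ hk' (by norm_num)
            · exact le_self_pow₀ (by linarith) (by norm_num)
        _ = (k * √d * z ^ 2) ^ 4 := by
            conv_lhs => rw [hdd]
            ring
        _ ≤ F ^ 4 := by gcongr
    have hc : 10 ≤ F ^ 2 := by nlinarith
    calc (d : ℝ) * (m + 1) ≤ 10 * (k * d ^ 2 * z) := ha
      _ ≤ F ^ 2 * F ^ 4 := by gcongr
      _ = F ^ 6 := by ring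
  have hF0 : 0 < F := by linarith
  -- The base is at most `F ^ 6` and the exponent at most `21 * F`, whence `126 = 6 * 21`.
  calc ((d : ℝ) * (m + 1)) ^ (t + 4) ≤ (F ^ 6) ^ (t + 4) := by gcongr
    _ = (F ^ 6) ^ ((t + 4 : ℕ) : ℝ) := (Real.rpow_natCast _ _).symm
    _ ≤ (F ^ 6) ^ (21 * F) := Real.rpow_le_rpow_of_exponent_le (one_le_pow₀ (by linarith)) ht21
    _ = (((2 : ℝ) ^ Real.logb 2 F) ^ 6) ^ (21 * F) := by
        rw [Real.rpow_logb two_pos (by norm_num) hF0]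
    _ = (2 : ℝ) ^ (126 * (F * Real.logb 2 F ^ 1)) := by
        rw [← Real.rpow_natCast, ← Real.rpow_mul two_pos.le, ← Real.rpow_mul two_pos.le]
        congr 1
        push_cast
        ring

end Testers

end KMonoTesting

theorem mainTheorem1 :
    (∃ (T : (p : KMonoTesting.Params) →
          KMonoTesting.NonadaptiveTester (KMonoTesting.Grid p.n p.d))
        (q : KMonoTesting.Params → ℕ),
      KMonoTesting.IsKMonoTolerantTester KMonoTesting.fullRange T q ∧
      KMonoTesting.IsSoftO KMonoTesting.fullRange (fun p => (q p : ℝ))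
        (fun p => 1 / (p.ε₂ - p.ε₁) ^ 2 *
          (5 * (p.k : ℝ) * (p.d : ℝ) / (p.ε₂ - p.ε₁)) ^ p.d)) ∧
    (∃ (T : (p : KMonoTesting.Params) →
          KMonoTesting.NonadaptiveTester (KMonoTesting.Grid p.n p.d))
        (q : KMonoTesting.Params → ℕ) (e : KMonoTesting.Params → ℝ),
      KMonoTesting.IsKMonoTolerantTester KMonoTesting.restrictedRange T q ∧
      KMonoTesting.IsSoftO KMonoTesting.restrictedRange e
        (fun p => (p.k : ℝ) * Real.sqrt (p.d : ℝ) / (p.ε₂ - 3 * p.ε₁) ^ 2) ∧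
      ∀ p ∈ KMonoTesting.restrictedRange, (q p : ℝ) ≤ (2 : ℝ) ^ e p) := by
  classical
  open KMonoTesting in
  have h1 : ∀ p : Params, ∃ (T : NonadaptiveTester (Grid p.n p.d)) (s : ℕ), p ∈ fullRange →
      T.MakesAtMost s ∧ T.IsTolerantTester (kMonotoneProperty (Grid p.n p.d) p.k) p.ε₁ p.ε₂ ∧
      (s : ℝ) ≤ 193 * (1 / (p.ε₂ - p.ε₁) ^ 2 * (5 * p.k * p.d / (p.ε₂ - p.ε₁)) ^ p.d) := by
    intro p
    by_cases hp : p ∈ fullRange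
    · obtain ⟨T, s, h⟩ := exists_tester_fullRange hp
      exact ⟨T, s, fun _ => h⟩
    · exact ⟨acceptTester _, 0, fun h => absurd h hp⟩
  open KMonoTesting in
  have h2 : ∀ p : Params, ∃ (T : NonadaptiveTester (Grid p.n p.d)) (s : ℕ),
      p ∈ restrictedRange →
      T.MakesAtMost s ∧ T.IsTolerantTester (kMonotoneProperty (Grid p.n p.d) p.k) p.ε₁ p.ε₂ ∧
      (s : ℝ) ≤ (2 : ℝ) ^ (126 * (p.k * √p.d / (p.ε₂ - 3 * p.ε₁) ^ 2 *
        Real.logb 2 (p.k * √p.d / (p.ε₂ - 3 * p.ε₁) ^ 2) ^ 1)) := by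
    intro p
    by_cases hp : p ∈ restrictedRange
    · obtain ⟨T, s, h⟩ := exists_tester_restrictedRange hp
      exact ⟨T, s, fun _ => h⟩
    · exact ⟨acceptTester _, 0, fun h => absurd h hp⟩
  choose T q hT using h1
  choose T' q' hT' using h2
  -- The first bound needs no logarithmic factor (`c = 0`); in the second, `e` is the explicit
  -- exponent itself, with `C = 126` and `c = 1`.
  refine ⟨⟨T, q, fun p hp => ⟨(hT p hp).1, (hT p hp).2.1⟩, 193, 0, fun p hp => ?_⟩,
    ⟨T', q', _, fun p hp => ⟨(hT' p hp).1, (hT' p hp).2.1⟩, ⟨126, 1, fun p _ => le_rfl⟩,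
      fun p hp => (hT' p hp).2.2⟩⟩
  simpa using (hT p hp).2.2
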